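/- Let $n\ge 2$, $1<p<\infty$ and $\kappa>0$. Write points of $\mathbf R^n$ as $x=(x',x_n)$ with $x'\in\mathbf R^{n-1}$, let $B'=\{x'\in\mathbf R^{n-1}:|x'|<1\}$ and $G=B'\times(0,\infty)$, and for $t\ge 0$ let $G_t=\overline{B'}\times(t,\infty)$ and $Q_t=\overline{B'}\times[0,t]$. Let $L^{1,p}_{\kappa,0}(\overline G\setminus Q_t)$ be the completion of the set of restrictions to $\overline G$ of functions in $C_0^\infty(\mathbf R^n\setminus Q_t)$ with respect to the norm $$\|v\|=\Bigl(\int_{G\setminus Q_t}\bigl(|v(x)|^p e^{-p\kappa x_n}+|\nabla v(x)|^p\bigr)\,dx\Bigr)^{1/p},$$ where $\nabla v$ is the distributional gradient. For $E\subset G_t$ let $$\operatorname{cap}_{p,G_t}(E)=\inf_v\int_{G_t}|\nabla v|^p\,dx,$$ the infimum being over all $v\in L^{1,p}_{\kappa,0}(\overline G\setminus Q_t)$ such that $v\ge 1$ almost everywhere in $G_t\cap U$ for some open set $U\supset E$. Let $C_p$ be the Sobolev $p$-capacity on $\mathbf R^n$: for compact $K$, $$C_p(K)=\inf\Bigl\{\int_{\mathbf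 R^n}(|v|^p+|\nabla v|^p)\,dx : v\in C_0^\infty(\mathbf R^n),\ v\ge 1\text{ on }K\Bigr\};$$ for open $U$, $C_p(U)=\sup\{C_p(K):K\subset U\text{ compact}\}$; and for arbitrary $E\subset\mathbf R^n$, $C_p(E)=\inf\{C_p(U):U\supset E\text{ open}\}$. Then there is a constant $C\ge 0$, depending only on $n$, $p$ and $\kappa$, such that for every $t\ge 1$ and every set $E\subset\overline{G_t}\setminus G_{t+1}$, $$C_p(E)\le C\,\operatorname{cap}_{p,G_{t-1}}(E).$$ -/

import Mathlib

open MeasureTheory Set Filter Topology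
open scoped ENNReal NNReal ContDiff Gradient

noncomputable section

namespace HalfCylinder

/-- `ℝⁿ` with its Euclidean norm, where `n = d + 1`. -/
abbrev Space (d : ℕ) : Type := EuclideanSpace ℝ (Fin (d + 1))

/-- The first `n - 1` coordinates `x'` of `x = (x', xₙ)`. -/
def base {d : ℕ} (x : Space d) : EuclideanSpace ℝ (Fin d) :=
  WithLp.toLp 2 fun i => x i.castSucc

/-- The last coordinate `xₙ` of `x = (x', xₙ)`. -/
def height {d : ℕ} (x : Space d) : ℝ := x (Fin.last d)

/-- The open half-cylinder `G = B' × (0, ∞)`, where `B'` is the open unit ball of `ℝⁿ⁻¹`. -/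
def openCyl (d : ℕ) : Set (Space d) := {x | ‖base x‖ < 1 ∧ 0 < height x}

/-- `G_t = closure B' × (t, ∞)`. -/
def trunc (d : ℕ) (t : ℝ) : Set (Space d) := {x | ‖base x‖ ≤ 1 ∧ t < height x}

/-- `Q_t = closure B' × [0, t]`. -/
def bottom (d : ℕ) (t : ℝ) : Set (Space d) :=
  {x | ‖base x‖ ≤ 1 ∧ 0 ≤ height x ∧ height x ≤ t}

/-- `φ ∈ C₀^∞(Ω)`: smooth on `ℝⁿ` with compact support contained in `Ω`. -/
def IsTest {d : ℕ} (Ω : Set (Space d)) (φ : Space d → ℝ) : Prop :=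
  ContDiff ℝ ∞ φ ∧ HasCompactSupport φ ∧ tsupport φ ⊆ Ω

/-- `g` is the distributional gradient of `v` in the open set `Ω`. -/
def HasWeakGradient {d : ℕ} (Ω : Set (Space d)) (v : Space d → ℝ) (g : Space d → Space d) :
    Prop :=
  LocallyIntegrableOn v Ω ∧ LocallyIntegrableOn g Ω ∧
    ∀ φ : Space d → ℝ, IsTest Ω φ → ∫ x in Ω, v x • ∇ φ x = -∫ x in Ω, φ x • g x

/-- The `L^{1,p}_κ(Ω)`-norm of a function `v` with distributional gradient `g` in `Ω`:
`(∫_Ω |v(x)|^p e^{-pκxₙ} + |g(x)|^p dx)^{1/p}`, as an extended nonnegative number. -/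
def wNorm {d : ℕ} (κ p : ℝ) (Ω : Set (Space d)) (v : Space d → ℝ) (g : Space d → Space d) :
    ℝ≥0∞ :=
  (∫⁻ x in Ω, (‖v x‖ₑ ^ p * ENNReal.ofReal (Real.exp (-(p * κ * height x))) + ‖g x‖ₑ ^ p))
    ^ (1 / p)

/-- `v` belongs to `L^{1,p}_κ(G \ F)`, and `g` is its distributional gradient. -/
def MemL {d : ℕ} (κ p : ℝ) (F : Set (Space d)) (v : Space d → ℝ) (g : Space d → Space d) :
    Prop :=
  HasWeakGradient (openCyl d \ F) v g ∧ wNorm κ p (openCyl d \ F) v g < ⊤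

/-- `v` belongs to `L^{1,p}_{κ,0}(closure G \ F)`, and `g` is its distributional gradient in
`G \ F`. The space is the completion, realized as the closure inside the complete space
`L^{1,p}_κ(G \ F)`, of the restrictions of the functions in `C₀^∞(ℝⁿ \ F)`; these need not
vanish on the part of `∂G` outside `F`. -/
def MemLZero {d : ℕ} (κ p : ℝ) (F : Set (Space d)) (v : Space d → ℝ) (g : Space d → Space d) :
    Prop :=
  MemL κ p F v g ∧
    ∃ φ : ℕ → Space d → ℝ, (∀ j, IsTest Fᶜ (φ j)) ∧
      Tendsto (fun j => wNorm κ p (openCyl d \ F) (fun x => v x - φ j x)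
        (fun x => g x - ∇ (φ j) x)) atTop (𝓝 0)

/-- The Neumann variational `p`-capacity `cap_{p,G_t}(E)` of a set `E ⊆ G_t`. The competitors
`v` are defined up to null sets, so `v ≥ 1` in `G_t ∩ U` means almost everywhere. -/
def neumannCap {d : ℕ} (κ p t : ℝ) (E : Set (Space d)) : ℝ≥0∞ :=
  ⨅ (v : Space d → ℝ) (g : Space d → Space d)
    (_ : MemLZero κ p (bottom d t) v g)
    (_ : ∃ U : Set (Space d), IsOpen U ∧ E ⊆ U ∧
      ∀ᵐ x ∂(volume.restrict (trunc d t ∩ U)), 1 ≤ v x),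
    ∫⁻ x in trunc d t, ‖g x‖ₑ ^ p

/-- The Sobolev capacity `C_p(K)` of a compact set `K ⊆ ℝⁿ`. -/
def sobolevCapCompact {d : ℕ} (p : ℝ) (K : Set (Space d)) : ℝ≥0∞ :=
  ⨅ (v : Space d → ℝ) (_ : IsTest univ v) (_ : ∀ x ∈ K, 1 ≤ v x),
    ∫⁻ x, (‖v x‖ₑ ^ p + ‖∇ v x‖ₑ ^ p)

/-- The Sobolev capacity `C_p(U)` of an open set `U ⊆ ℝⁿ`. -/
def sobolevCapOpen {d : ℕ} (p : ℝ) (U : Set (Space d)) : ℝ≥0∞ :=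
  ⨆ (K : Set (Space d)) (_ : IsCompact K) (_ : K ⊆ U), sobolevCapCompact p K

/-- The Sobolev capacity `C_p(E)` of an arbitrary set `E ⊆ ℝⁿ`, extended from compact sets to
open sets and then to arbitrary sets. -/
def sobolevCap {d : ℕ} (p : ℝ) (E : Set (Space d)) : ℝ≥0∞ :=
  ⨅ (U : Set (Space d)) (_ : IsOpen U) (_ : E ⊆ U), sobolevCapOpen p U

end HalfCylinder

end

/-! Inversion x' ↦ x'/|x'|² of the base variable carries functions on the cylinder across its
lateral surface. The resulting retraction `fold` is 1-Lipschitz, and up to radius two it distorts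
volume boundedly (`map_fold_le`). Composing with it and cutting off around E therefore costs only a
factor depending on n and p (`lintegral_extend_le`). The zero-order term of the Sobolev norm is
absorbed by a Poincaré inequality along vertical segments (`lintegral_slab_le`), since the
approximating test functions vanish on Q_{t-1}.

The extensions are only Lipschitz, and the test functions φ_j approximating a competitor v need not
be at least 1 near E. Both defects are cured by mollification, which does not increase the Sobolev
energy (`lintegral_mollify_le`). For a compact K in a fixed open neighborhood of E, fix a mollifier
of radius adapted to K. Since φ_j → v in L¹ on the slab, the mollified extension is at least 1/2 on
K for large j (`lintegral_bumpMeasure_le`), so twice it competes for C_p(K). Letting j → ∞ turns the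
energy of φ_j into that of v. How large j must be depends on K, t and κ, but the constant does not.
-/

namespace HalfCylinder

/-! ### Reflection in the lateral surface -/

section Geometry

variable {d : ℕ}

/-- The point `(a, h)` of `ℝⁿ⁻¹ × ℝ`. -/
def ofParts (a : EuclideanSpace ℝ (Fin d)) (h : ℝ) : Space d :=
  WithLp.toLp 2 (Fin.snoc (α := fun _ => ℝ) a h)

@[simp] lemma base_ofParts (a : EuclideanSpace ℝ (Fin d)) (h : ℝ) : base (ofParts a h) = a := by
  ext i; simp [base, ofParts]

@[simp] lemma height_ofParts (a : EuclideanSpace ℝ (Fin d)) (h : ℝ) :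
    height (ofParts a h) = h := by
  simp [height, ofParts]

@[simp] lemma ofParts_base_height (x : Space d) : ofParts (base x) (height x) = x := by
  ext i
  refine Fin.lastCases ?_ (fun j => ?_) i <;> simp [base, height, ofParts]

lemma norm_sq_eq (x : Space d) : ‖x‖ ^ 2 = ‖base x‖ ^ 2 + height x ^ 2 := by
  simp [EuclideanSpace.norm_sq_eq, Fin.sum_univ_castSucc, base, height]

lemma base_add (x y : Space d) : base (x + y) = base x + base y := rfl
lemma base_sub (x y : Space d) : base (x - y) = base x - base y := rfl
lemma base_smul (c : ℝ) (x : Space d) : base (c • x) = c • base x := rfl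
lemma height_sub (x y : Space d) : height (x - y) = height x - height y := rfl
lemma height_smul (c : ℝ) (x : Space d) : height (c • x) = c * height x := rfl

lemma norm_base_le (x : Space d) : ‖base x‖ ≤ ‖x‖ :=
  abs_le_of_sq_le_sq' (by nlinarith [norm_sq_eq x, sq_nonneg (height x)]) (norm_nonneg x) |>.2

lemma abs_height_le (x : Space d) : |height x| ≤ ‖x‖ :=
  abs_le_of_sq_le_sq (by nlinarith [norm_sq_eq x, sq_nonneg ‖base x‖]) (norm_nonneg x)

lemma continuous_base : Continuous (base : Space d → EuclideanSpace ℝ (Fin d)) := by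
  unfold base; fun_prop

lemma continuous_height : Continuous (height : Space d → ℝ) := by
  unfold height; fun_prop

/-- Heights are preserved exactly, so their contribution is dominated as soon as 1 ≤ K. -/
lemma lipschitzOnWith_of_parts {K : ℝ≥0} (hK : 1 ≤ K) {f : Space d → Space d} {s : Set (Space d)}
    (hh : ∀ x, height (f x) = height x)
    (hb : ∀ x ∈ s, ∀ y ∈ s, ‖base (f x) - base (f y)‖ ≤ K * ‖base x - base y‖) :
    LipschitzOnWith K f s := by
  refine LipschitzOnWith.of_dist_le_mul fun x hx y hy => ?_
  rw [dist_eq_norm, dist_eq_norm]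
  refine abs_le_of_sq_le_sq' ?_ (by positivity) |>.2
  rw [mul_pow, norm_sq_eq, norm_sq_eq (x - y), base_sub, base_sub, height_sub, height_sub, hh, hh]
  have h1 := pow_le_pow_left₀ (norm_nonneg _) (hb x hx y hy) 2
  rw [mul_pow] at h1
  have h2 : (1 : ℝ) ≤ (K : ℝ) ^ 2 := one_le_pow₀ (by exact_mod_cast hK)
  nlinarith [sq_nonneg (height x - height y)]

/-- The reflection `(x', xₙ) ↦ (x' / |x'|², xₙ)` in the lateral surface of the unit cylinder. -/
noncomputable def reflect (x : Space d) : Space d := ofParts ((‖base x‖ ^ 2)⁻¹ • base x) (height x)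

/-- The retraction onto the closed unit cylinder that reflects the points of its exterior. -/
noncomputable def fold (x : Space d) : Space d := ofParts ((max 1 ‖base x‖ ^ 2)⁻¹ • base x) (height x)

@[simp] lemma height_fold (x : Space d) : height (fold x) = height x := by simp [fold]

@[simp] lemma height_reflect (x : Space d) : height (reflect x) = height x := by simp [reflect]

lemma fold_of_le {x : Space d} (hx : ‖base x‖ ≤ 1) : fold x = x := by
  simp [fold, max_eq_left hx]

lemma fold_of_ge {x : Space d} (hx : 1 ≤ ‖base x‖) : fold x = reflect x := by
  simp [fold, reflect, max_eq_right hx]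

lemma norm_base_reflect (x : Space d) : ‖base (reflect x)‖ = ‖base x‖⁻¹ := by
  rw [reflect, base_ofParts, norm_smul, norm_inv, norm_pow, norm_norm]
  rcases eq_or_ne ‖base x‖ 0 with h | h
  · simp [h]
  · field_simp

lemma reflect_reflect {x : Space d} (hx : base x ≠ 0) : reflect (reflect x) = x := by
  have h : ‖base x‖ ≠ 0 := norm_ne_zero_iff.2 hx
  conv_rhs => rw [← ofParts_base_height x]
  conv_lhs => rw [reflect]
  rw [norm_base_reflect, height_reflect]
  congr 1
  rw [reflect, base_ofParts, smul_smul]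
  convert one_smul ℝ (base x) using 2
  field_simp

lemma norm_inv_sq_smul_sub {E : Type*} [NormedAddCommGroup E] [InnerProductSpace ℝ E] {a b : E}
    (ha : a ≠ 0) (hb : b ≠ 0) :
    ‖(‖a‖ ^ 2)⁻¹ • a - (‖b‖ ^ 2)⁻¹ • b‖ = ‖a - b‖ / (‖a‖ * ‖b‖) := by
  have := EuclideanGeometry.dist_inversion_inversion (c := (0 : E)) ha hb 1
  simpa [EuclideanGeometry.inversion, dist_eq_norm, div_eq_inv_mul] using this

/-- With c = |b|⁻², the difference of the squared norms is (1 - c)(1 + |b|² - 2⟨a, b⟩). This is at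
least (1 - c)(|b| - 1)² ≥ 0, because ⟨a, b⟩ ≤ |b|. -/
lemma norm_sub_inv_sq_smul_le {E : Type*} [NormedAddCommGroup E] [InnerProductSpace ℝ E] {a b : E}
    (ha : ‖a‖ ≤ 1) (hb : 1 ≤ ‖b‖) : ‖a - (‖b‖ ^ 2)⁻¹ • b‖ ≤ ‖a - b‖ := by
  refine abs_le_of_sq_le_sq' ?_ (norm_nonneg _) |>.2
  rw [norm_sub_sq_real, norm_sub_sq_real, norm_smul, norm_inv, norm_pow, norm_norm,
    real_inner_smul_right]
  have hb0 : ‖b‖ ≠ 0 := by positivity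
  set c := (‖b‖ ^ 2)⁻¹ with hc
  have hc1 : c * ‖b‖ ^ 2 = 1 := by rw [hc]; field_simp
  have hc2 : c ≤ 1 := inv_le_one_of_one_le₀ (one_le_pow₀ hb)
  have hi : inner ℝ a b ≤ ‖b‖ := (real_inner_le_norm a b).trans (by nlinarith [norm_nonneg b])
  have h1 : (c * ‖b‖) ^ 2 = c := by
    calc (c * ‖b‖) ^ 2 = c * (c * ‖b‖ ^ 2) := by ring
      _ = c := by rw [hc1, mul_one]
  rw [h1]
  have h2 : (1 - c) * (2 * inner ℝ a b) ≤ (1 - c) * (1 + ‖b‖ ^ 2) :=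
    mul_le_mul_of_nonneg_left (by nlinarith [sq_nonneg (‖b‖ - 1)]) (by linarith)
  nlinarith

lemma lipschitzWith_fold : LipschitzWith 1 (fold : Space d → Space d) := by
  rw [← lipschitzOnWith_univ]
  refine lipschitzOnWith_of_parts le_rfl height_fold fun x _ y _ => ?_
  simp only [NNReal.coe_one, one_mul]
  rcases le_total ‖base x‖ 1 with hx | hx <;> rcases le_total ‖base y‖ 1 with hy | hy
  · rw [fold_of_le hx, fold_of_le hy]
  · rw [fold_of_le hx, fold_of_ge hy, reflect, base_ofParts]
    exact norm_sub_inv_sq_smul_le hx hy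
  · rw [fold_of_ge hx, fold_of_le hy, reflect, base_ofParts, norm_sub_rev,
      norm_sub_rev (base x)]
    exact norm_sub_inv_sq_smul_le hy hx
  · rw [fold_of_ge hx, fold_of_ge hy, reflect, base_ofParts, reflect, base_ofParts,
      norm_inv_sq_smul_sub (norm_pos_iff.1 (by linarith)) (norm_pos_iff.1 (by linarith))]
    exact div_le_self (norm_nonneg _) (by nlinarith)

/-- Inversion scales distances by 1/(|a||b|), which is at most 4 when both radii are at least 1/2.
-/
lemma lipschitzOnWith_reflect :
    LipschitzOnWith 4 (reflect : Space d → Space d) {x | 1 / 2 ≤ ‖base x‖} := by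
  refine lipschitzOnWith_of_parts (by norm_num) height_reflect fun x hx y hy => ?_
  simp only [mem_ofPred_eq] at hx hy
  rw [reflect, base_ofParts, reflect, base_ofParts,
      norm_inv_sq_smul_sub (norm_pos_iff.1 (by linarith)) (norm_pos_iff.1 (by linarith))]
  rw [div_le_iff₀ (by nlinarith)]
  have h1 : 1 / 4 ≤ ‖base x‖ * ‖base y‖ := by nlinarith
  have h2 := norm_nonneg (base x - base y)
  push_cast
  nlinarith

/-- The bound holds for n-dimensional Hausdorff measure, which is a Haar measure and hence a
multiple of Lebesgue measure. -/
lemma volume_image_le_of_lipschitzOnWith {K : ℝ≥0} {f : Space d → Space d} {s : Set (Space d)}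
    (hf : LipschitzOnWith K f s) : volume (f '' s) ≤ (K : ℝ≥0∞) ^ (d + 1) * volume s := by
  have hdim : (Module.finrank ℝ (Space d) : ℝ) = ((d + 1 : ℕ) : ℝ) := by simp
  have key := hf.hausdorffMeasure_image_le (d := ((d + 1 : ℕ) : ℝ)) (by positivity)
  have : (Measure.hausdorffMeasure ((d + 1 : ℕ) : ℝ) : Measure (Space d)).IsAddHaarMeasure := by
    rw [← hdim]; exact MeasureTheory.isAddHaarMeasure_hausdorffMeasure
  set μ : Measure (Space d) := Measure.hausdorffMeasure ((d + 1 : ℕ) : ℝ)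
  have hμ := Measure.isAddLeftInvariant_eq_smul (volume : Measure (Space d)) μ
  rw [hμ, Measure.smul_apply, Measure.smul_apply, mul_smul_comm]
  rw [ENNReal.rpow_natCast] at key
  gcongr

/-- The part of the closed cylinder of height three above the level `s`. -/
def slab (d : ℕ) (s : ℝ) : Set (Space d) := {x | ‖base x‖ ≤ 1 ∧ s < height x ∧ height x < s + 3}

lemma measurableSet_slab (s : ℝ) : MeasurableSet (slab d s) := by
  refine .inter ?_ (.inter ?_ ?_)
  · exact (isClosed_le continuous_base.norm continuous_const).measurableSet
  · exact (isOpen_lt continuous_const continuous_height).measurableSet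
  · exact (isOpen_lt continuous_height continuous_const).measurableSet

/-- The part of the closed cylinder of radius two between the levels `s` and `s + 3`. -/
def wideSlab (d : ℕ) (s : ℝ) : Set (Space d) :=
  {x | ‖base x‖ ≤ 2 ∧ s < height x ∧ height x < s + 3}

lemma measurableSet_wideSlab (s : ℝ) : MeasurableSet (wideSlab d s) := by
  refine .inter ?_ (.inter ?_ ?_)
  · exact (isClosed_le continuous_base.norm continuous_const).measurableSet
  · exact (isOpen_lt continuous_const continuous_height).measurableSet
  · exact (isOpen_lt continuous_height continuous_const).measurableSet

/-- A point has at most two kinds of preimage: itself, giving the term 1, and its reflection.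
Reflected points of radius at most 2 come from radius at least 1/2, where `reflect` is 4-Lipschitz;
this gives the term 4ⁿ. -/
lemma map_fold_le (s : ℝ) :
    (volume.restrict (wideSlab d s)).map fold ≤
      (1 + (4 : ℝ≥0∞) ^ (d + 1)) • volume.restrict (slab d s) := by
  refine Measure.le_iff.2 fun S hS => ?_
  have hm : Measurable (fold : Space d → Space d) := lipschitzWith_fold.continuous.measurable
  rw [Measure.map_apply hm hS, Measure.restrict_apply (hm hS), Measure.smul_apply,
    Measure.restrict_apply hS, smul_eq_mul, add_mul, one_mul]
  have hsub : fold ⁻¹' S ∩ wideSlab d s ⊆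
      (S ∩ slab d s) ∪ reflect '' ((S ∩ slab d s) ∩ {x | 1 / 2 ≤ ‖base x‖}) := by
    rintro x ⟨hxS, hx2, hxs⟩
    rcases le_total ‖base x‖ 1 with h | h
    · left
      rw [mem_preimage, fold_of_le h] at hxS
      exact ⟨hxS, h, hxs⟩
    · right
      rw [mem_preimage, fold_of_ge h] at hxS
      refine ⟨reflect x, ⟨⟨hxS, ?_, ?_⟩, ?_⟩, reflect_reflect (norm_pos_iff.1 (by linarith))⟩
      · rw [norm_base_reflect]; exact inv_le_one_of_one_le₀ h
      · rwa [height_reflect]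
      · simp only [mem_ofPred_eq, norm_base_reflect, one_div]
        exact inv_anti₀ (by linarith) hx2
  refine (measure_mono hsub).trans ((measure_union_le _ _).trans ?_)
  gcongr
  refine (volume_image_le_of_lipschitzOnWith
    (lipschitzOnWith_reflect.mono inter_subset_right)).trans ?_
  exact mul_le_mul' (by norm_num) (measure_mono inter_subset_left)

/-- The lateral surface lies in the frontier of a convex set. Its nullity makes G \ Q_s and G_s
interchangeable in integrals. -/
lemma volume_norm_base_eq_one : volume {x : Space d | ‖base x‖ = 1} = 0 := by
  have hconv : Convex ℝ {x : Space d | ‖base x‖ < 1} := by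
    intro x hx y hy a b ha hb hab
    simp only [mem_ofPred_eq] at hx hy ⊢
    rw [base_add, base_smul, base_smul]
    have := (convex_ball (0 : EuclideanSpace ℝ (Fin d)) 1) (x := base x) (by simpa using hx)
      (y := base y) (by simpa using hy) ha hb hab
    simpa using this
  refine measure_mono_null (fun x hx => ?_) (hconv.addHaar_frontier volume)
  have hx' : ‖base x‖ = 1 := hx
  refine ⟨?_, fun h => ?_⟩
  · have hlim : Tendsto (fun r : ℝ => r • x) (𝓝[<] 1) (𝓝 x) := by
      have : Continuous fun r : ℝ => r • x := by fun_prop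
      simpa using (this.tendsto 1).mono_left nhdsWithin_le_nhds
    refine mem_closure_of_tendsto hlim ?_
    filter_upwards [Ioo_mem_nhdsLT (show (0 : ℝ) < 1 by norm_num)] with r hr
    simp only [base_smul, norm_smul, hx', mul_one, Real.norm_eq_abs]
    rw [abs_of_pos hr.1]; exact hr.2
  · have := interior_subset h
    simp only [mem_ofPred_eq, hx'] at this
    exact lt_irrefl _ this

end Geometry

/-! ### Mollification and the Sobolev energy -/

section Mollification

open scoped Convolution

lemma lintegral_rpow_le_lintegral_rpow {α : Type*} [MeasurableSpace α] {ν : Measure α}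
    [IsProbabilityMeasure ν] {p : ℝ} (hp : 1 ≤ p) {f : α → ℝ≥0∞} (hf : AEMeasurable f ν) :
    (∫⁻ y, f y ∂ν) ^ p ≤ ∫⁻ y, f y ^ p ∂ν := by
  have hp0 : 0 < p := by linarith
  have h2 : eLpNorm f 1 ν ≤ eLpNorm f (ENNReal.ofReal p) ν :=
    eLpNorm_le_eLpNorm_of_exponent_le (by simpa using hp) hf.aestronglyMeasurable
  rw [eLpNorm_one_eq_lintegral_enorm,
    eLpNorm_eq_lintegral_rpow_enorm_toReal (p := ENNReal.ofReal p) (by simpa using hp0) (by simp),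
    ENNReal.toReal_ofReal hp0.le] at h2
  rw [← ENNReal.le_rpow_inv_iff hp0, ← one_div]
  simpa using h2

lemma enorm_integral_rpow_le {α E : Type*} [MeasurableSpace α] {ν : Measure α}
    [IsProbabilityMeasure ν] [NormedAddCommGroup E] [NormedSpace ℝ E] {p : ℝ} (hp : 1 ≤ p)
    {f : α → E} (hf : AEStronglyMeasurable f ν) :
    ‖∫ y, f y ∂ν‖ₑ ^ p ≤ ∫⁻ y, ‖f y‖ₑ ^ p ∂ν :=
  (ENNReal.rpow_le_rpow (enorm_integral_le_lintegral_enorm f) (by linarith)).trans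
    (lintegral_rpow_le_lintegral_rpow hp hf.enorm)

variable {d : ℕ}

/-- The probability measure whose density is a normalized bump function. -/
noncomputable def bumpMeasure (ρ : ContDiffBump (0 : Space d)) : Measure (Space d) :=
  volume.withDensity fun y => ENNReal.ofReal (ρ.normed volume y)

instance (ρ : ContDiffBump (0 : Space d)) : IsProbabilityMeasure (bumpMeasure ρ) := by
  constructor
  rw [bumpMeasure, withDensity_apply _ MeasurableSet.univ, Measure.restrict_univ,
    ← ofReal_integral_eq_lintegral_ofReal ρ.integrable_normed
      (ae_of_all _ fun x => ρ.nonneg_normed x), ρ.integral_normed, ENNReal.ofReal_one]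

lemma bumpMeasure_absolutelyContinuous (ρ : ContDiffBump (0 : Space d)) :
    bumpMeasure ρ ≪ volume := withDensity_absolutelyContinuous _ _

/-- The mollification of `V` by a normalized bump function. -/
noncomputable def mollify (ρ : ContDiffBump (0 : Space d)) (V : Space d → ℝ) (x : Space d) : ℝ :=
  ∫ y, V (x - y) ∂bumpMeasure ρ

lemma mollify_eq_convolution (ρ : ContDiffBump (0 : Space d)) (V : Space d → ℝ) :
    mollify ρ V = ρ.normed volume ⋆[ContinuousLinearMap.lsmul ℝ ℝ, volume] V := by
  ext x
  rw [mollify, bumpMeasure, integral_withDensity_eq_integral_toReal_smul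
    (ρ.continuous_normed.measurable.ennreal_ofReal) (by simp)]
  refine integral_congr_ae (ae_of_all _ fun y => ?_)
  simp [ENNReal.toReal_ofReal (ρ.nonneg_normed y)]

lemma contDiff_mollify (ρ : ContDiffBump (0 : Space d)) {V : Space d → ℝ} (hV : Continuous V) :
    ContDiff ℝ ∞ (mollify ρ V) := by
  rw [mollify_eq_convolution]
  exact ρ.hasCompactSupport_normed.contDiff_convolution_left _ ρ.contDiff_normed
    hV.locallyIntegrable

lemma hasCompactSupport_mollify (ρ : ContDiffBump (0 : Space d)) {V : Space d → ℝ}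
    (hV : HasCompactSupport V) : HasCompactSupport (mollify ρ V) := by
  rw [mollify_eq_convolution]
  exact ρ.hasCompactSupport_normed.convolution _ hV

lemma ae_sub_left {P : Space d → Prop} (h : ∀ᵐ y, P y) (x : Space d) : ∀ᵐ y, P (x - y) :=
  (Measure.measurePreserving_sub_left volume x).quasiMeasurePreserving.ae h

/-- Rademacher's theorem gives the derivative of V almost everywhere, and the Lipschitz constant
dominates the difference quotients. -/
lemma fderiv_mollify (ρ : ContDiffBump (0 : Space d)) {V : Space d → ℝ} {L : ℝ≥0}
    (hV : LipschitzWith L V) (hc : HasCompactSupport V) (x : Space d) :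
    fderiv ℝ (mollify ρ V) x = ∫ y, fderiv ℝ V (x - y) ∂bumpMeasure ρ := by
  obtain ⟨M, hM⟩ := hV.continuous.bounded_above_of_compact_support hc
  have hsub : ∀ x : Space d, Continuous fun y => V (x - y) := fun x =>
    hV.continuous.comp (by fun_prop)
  refine HasFDerivAt.fderiv (hasFDerivAt_integral_of_dominated_loc_of_lip (bound := fun _ => L)
    (s := univ) univ_mem (.of_forall fun x => (hsub x).aestronglyMeasurable) ?_ ?_ ?_
    (integrable_const _) ?_).2
  · exact (integrable_const M).mono' (hsub x).aestronglyMeasurable (ae_of_all _ fun y => hM _)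
  · exact ((measurable_fderiv ℝ V).comp (by fun_prop)).aestronglyMeasurable
  · refine ae_of_all _ fun y => LipschitzWith.lipschitzOnWith ?_ |>.mono (subset_univ _)
    refine LipschitzWith.of_dist_le_mul fun a b => ?_
    simpa using hV.dist_le_mul (a - y) (b - y)
  · refine (bumpMeasure_absolutelyContinuous ρ).ae_le ?_
    filter_upwards [ae_sub_left hV.ae_differentiableAt x] with y hy
    have := hy.hasFDerivAt.comp x ((hasFDerivAt_id x).sub_const y)
    simpa [Function.comp_def] using this

lemma lintegral_lintegral_sub_bumpMeasure (ρ : ContDiffBump (0 : Space d)) {f : Space d → ℝ≥0∞}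
    (hf : Measurable f) : ∫⁻ x, ∫⁻ y, f (x - y) ∂bumpMeasure ρ = ∫⁻ x, f x := by
  rw [lintegral_lintegral_swap (by fun_prop)]
  simp [lintegral_sub_right_eq_self]

lemma enorm_gradient (v : Space d → ℝ) (x : Space d) : ‖∇ v x‖ₑ = ‖fderiv ℝ v x‖ₑ := by
  simp [gradient, enorm_eq_nnnorm]

/-- Jensen's inequality for the bump measure, followed by translation invariance of Lebesgue
measure. -/
lemma lintegral_mollify_le (ρ : ContDiffBump (0 : Space d)) {p : ℝ} (hp : 1 ≤ p)
    {V : Space d → ℝ} {L : ℝ≥0} (hV : LipschitzWith L V) (hc : HasCompactSupport V) :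
    ∫⁻ x, (‖mollify ρ V x‖ₑ ^ p + ‖fderiv ℝ (mollify ρ V) x‖ₑ ^ p) ≤
      ∫⁻ x, (‖V x‖ₑ ^ p + ‖fderiv ℝ V x‖ₑ ^ p) := by
  have hVm := hV.continuous.measurable
  have hDm := measurable_fderiv ℝ V
  calc ∫⁻ x, (‖mollify ρ V x‖ₑ ^ p + ‖fderiv ℝ (mollify ρ V) x‖ₑ ^ p)
      ≤ ∫⁻ x, ∫⁻ y, (‖V (x - y)‖ₑ ^ p + ‖fderiv ℝ V (x - y)‖ₑ ^ p) ∂bumpMeasure ρ := by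
        refine lintegral_mono fun x => ?_
        rw [lintegral_add_left (by fun_prop), fderiv_mollify ρ hV hc]
        refine add_le_add (enorm_integral_rpow_le hp ?_) (enorm_integral_rpow_le hp ?_)
        · exact (hVm.comp (by fun_prop)).aestronglyMeasurable
        · exact (hDm.comp (by fun_prop)).aestronglyMeasurable
    _ = _ := lintegral_lintegral_sub_bumpMeasure ρ
        (f := fun x => ‖V x‖ₑ ^ p + ‖fderiv ℝ V x‖ₑ ^ p) (by fun_prop)

lemma sobolevCapCompact_le_of_le_mollify (ρ : ContDiffBump (0 : Space d)) {p : ℝ} (hp : 1 ≤ p)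
    {V : Space d → ℝ} {L : ℝ≥0} (hV : LipschitzWith L V) (hc : HasCompactSupport V)
    {K : Set (Space d)} {c : ℝ} (hc0 : 0 < c) (hK : ∀ x ∈ K, c ≤ mollify ρ V x) :
    sobolevCapCompact p K ≤
      ‖c⁻¹‖ₑ ^ p * ∫⁻ x, (‖V x‖ₑ ^ p + ‖fderiv ℝ V x‖ₑ ^ p) := by
  have hsm := contDiff_mollify ρ hV.continuous
  have hp0 : 0 ≤ p := by linarith
  calc sobolevCapCompact p K
      ≤ ∫⁻ x, (‖c⁻¹ * mollify ρ V x‖ₑ ^ p + ‖∇ (fun x => c⁻¹ * mollify ρ V x) x‖ₑ ^ p) := by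
        refine iInf₂_le_of_le (fun x => c⁻¹ * mollify ρ V x)
          ⟨contDiff_const.mul hsm, (hasCompactSupport_mollify ρ hc).mul_left, subset_univ _⟩
          (iInf_le_of_le (fun x hx => ?_) le_rfl)
        rw [← inv_mul_cancel₀ hc0.ne']
        exact mul_le_mul_of_nonneg_left (hK x hx) (by positivity)
    _ = ∫⁻ x, ‖c⁻¹‖ₑ ^ p * (‖mollify ρ V x‖ₑ ^ p + ‖fderiv ℝ (mollify ρ V) x‖ₑ ^ p) := by
        refine lintegral_congr fun x => ?_
        rw [enorm_gradient, fderiv_const_mul (hsm.differentiable (by simp) x), enorm_mul,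
          enorm_smul, ENNReal.mul_rpow_of_nonneg _ _ hp0, ENNReal.mul_rpow_of_nonneg _ _ hp0,
          mul_add]
    _ = ‖c⁻¹‖ₑ ^ p * ∫⁻ x, (‖mollify ρ V x‖ₑ ^ p + ‖fderiv ℝ (mollify ρ V) x‖ₑ ^ p) :=
        lintegral_const_mul' _ _ (ENNReal.rpow_ne_top_of_nonneg hp0 enorm_ne_top)
    _ ≤ _ := mul_le_mul_right (lintegral_mollify_le ρ hp hV hc) _

end Mollification

/-! ### Poincaré inequality on a slab -/

section Poincare

variable {d : ℕ}

/-- Integrate the derivative down the vertical segment from x to level s, where φ vanishes. The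
indicator lets the range of τ be the same for all x, as Fubini requires. -/
lemma enorm_le_lintegral_fderiv {s : ℝ} (hs : 0 ≤ s) {φ : Space d → ℝ}
    (hφ : IsTest (bottom d s)ᶜ φ) {x : Space d} (hx : x ∈ slab d s) :
    ‖φ x‖ₑ ≤ ∫⁻ τ in Ioc (0 : ℝ) 3,
      (slab d s).indicator (fun y => ‖fderiv ℝ φ y‖ₑ) (x - τ • ofParts 0 1) := by
  obtain ⟨hx1, hx2, hx3⟩ := hx
  set e : Space d := ofParts 0 1 with he
  have hbe : base e = 0 := by simp [he]
  have hhe : height e = 1 := by simp [he]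
  have hne : ‖e‖ₑ = 1 := by
    have : ‖e‖ ^ 2 = 1 := by rw [norm_sq_eq, hbe, hhe]; simp
    rw [← ofReal_norm, (pow_eq_one_iff_of_nonneg (norm_nonneg e) two_ne_zero).1 this]
    simp
  set b := height x - s with hb
  have hb0 : 0 ≤ b := by linarith
  have hzero : φ (x - b • e) = 0 := by
    refine image_eq_zero_of_notMem_tsupport fun h => hφ.2.2 h ?_
    simp only [bottom, mem_ofPred_eq, base_sub, base_smul, height_sub, height_smul, hbe, hhe]
    refine ⟨by simpa using hx1, ?_, ?_⟩ <;> linarith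
  have hderiv : ∀ τ : ℝ, HasDerivAt (fun τ : ℝ => φ (x - τ • e))
      (fderiv ℝ φ (x - τ • e) (-e)) τ := by
    intro τ
    have h1 : HasDerivAt (fun τ : ℝ => x - τ • e) (-e) τ := by
      simpa using ((hasDerivAt_id τ).smul_const e).const_sub x
    exact ((hφ.1.differentiable (by simp)) _).hasFDerivAt.comp_hasDerivAt τ h1
  have hcont : Continuous fun τ : ℝ => fderiv ℝ φ (x - τ • e) (-e) :=
    ((hφ.1.continuous_fderiv (by simp)).comp (by fun_prop)).clm_apply continuous_const
  have hftc := intervalIntegral.integral_eq_sub_of_hasDerivAt (a := 0) (b := b)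
    (fun τ _ => hderiv τ) (hcont.intervalIntegrable _ _)
  -- The endpoint τ = b is dropped because it has height s, outside the slab.
  rw [hzero, zero_smul, sub_zero, zero_sub, intervalIntegral.integral_of_le hb0,
    ← restrict_Ioo_eq_restrict_Ioc] at hftc
  calc ‖φ x‖ₑ = ‖∫ τ in Ioo 0 b, fderiv ℝ φ (x - τ • e) (-e)‖ₑ := by rw [hftc, enorm_neg]
    _ ≤ ∫⁻ τ in Ioo 0 b, ‖fderiv ℝ φ (x - τ • e) (-e)‖ₑ := enorm_integral_le_lintegral_enorm _
    _ ≤ ∫⁻ τ in Ioo 0 b, (slab d s).indicator (fun y => ‖fderiv ℝ φ y‖ₑ) (x - τ • e) := by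
        refine setLIntegral_mono' measurableSet_Ioo fun τ hτ => ?_
        rw [indicator_of_mem]
        · refine (ContinuousLinearMap.le_opENorm _ _).trans_eq ?_
          rw [enorm_neg, hne, mul_one]
        · simp only [slab, mem_ofPred_eq, base_sub, base_smul, height_sub, height_smul, hbe, hhe]
          refine ⟨by simpa using hx1, ?_, ?_⟩ <;> linarith [hτ.1, hτ.2]
    _ ≤ _ := lintegral_mono_set (Ioo_subset_Ioc_self.trans (Ioc_subset_Ioc_right (by linarith)))

lemma lintegral_slab_le {p : ℝ} (hp : 1 ≤ p) {s : ℝ} (hs : 0 ≤ s) {φ : Space d → ℝ}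
    (hφ : IsTest (bottom d s)ᶜ φ) :
    ∫⁻ x in slab d s, ‖φ x‖ₑ ^ p ≤ 3 ^ p * ∫⁻ x in slab d s, ‖fderiv ℝ φ x‖ₑ ^ p := by
  have hp0 : 0 < p := by linarith
  -- Normalized so that Jensen's inequality applies; the factor 3 reappears as `3 ^ p`.
  set ν : Measure ℝ := (3 : ℝ≥0∞)⁻¹ • volume.restrict (Ioc (0 : ℝ) 3) with hν
  have hprob : IsProbabilityMeasure ν := by
    constructor
    rw [hν, Measure.smul_apply, Measure.restrict_apply MeasurableSet.univ, univ_inter,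
      Real.volume_Ioc]
    norm_num
    exact ENNReal.inv_mul_cancel (by norm_num) (by norm_num)
  set F : Space d → ℝ≥0∞ := (slab d s).indicator fun y => ‖fderiv ℝ φ y‖ₑ with hF
  have hFm : Measurable F := (measurable_fderiv ℝ φ).enorm.indicator (measurableSet_slab s)
  set e : Space d := ofParts 0 1
  have hint : ∀ x, ∫⁻ τ in Ioc (0 : ℝ) 3, F (x - τ • e) = 3 * ∫⁻ τ, F (x - τ • e) ∂ν := by
    intro x
    rw [hν, lintegral_smul_measure, smul_eq_mul, ← mul_assoc,
      ENNReal.mul_inv_cancel (by norm_num) (by norm_num), one_mul]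
  calc ∫⁻ x in slab d s, ‖φ x‖ₑ ^ p
      ≤ ∫⁻ x in slab d s, 3 ^ p * ∫⁻ τ, F (x - τ • e) ^ p ∂ν := by
        refine setLIntegral_mono' (measurableSet_slab s) fun x hx => ?_
        refine (ENNReal.rpow_le_rpow (enorm_le_lintegral_fderiv hs hφ hx) hp0.le).trans ?_
        rw [hint, ENNReal.mul_rpow_of_nonneg _ _ hp0.le]
        exact mul_le_mul_right (lintegral_rpow_le_lintegral_rpow hp
          (hFm.comp (by fun_prop)).aemeasurable) _
    _ ≤ ∫⁻ x, 3 ^ p * ∫⁻ τ, F (x - τ • e) ^ p ∂ν := setLIntegral_le_lintegral _ _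
    _ = 3 ^ p * ∫⁻ x, F x ^ p := by
        rw [lintegral_const_mul' _ _ (ENNReal.rpow_ne_top_of_nonneg hp0.le (by norm_num)),
          lintegral_lintegral_swap (by fun_prop)]
        simp [lintegral_sub_right_eq_self (fun x => F x ^ p)]
    _ = _ := by
        rw [← lintegral_indicator (measurableSet_slab s)]
        congr 2 with x
        by_cases hx : x ∈ slab d s <;> simp [hF, hx, hp0]

end Poincare

/-! ### Extension by reflection and cutoff -/

section Extension

variable {d : ℕ}

/-- The part of the closed unit cylinder between the levels `t` and `t + 1`. -/
def core (d : ℕ) (t : ℝ) : Set (Space d) := {x | ‖base x‖ ≤ 1 ∧ t ≤ height x ∧ height x ≤ t + 1}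

lemma core_nonempty (t : ℝ) : (core d t).Nonempty := ⟨ofParts 0 t, by simp [core]⟩

/-- A Lipschitz cutoff function equal to one near `core d t`. -/
noncomputable def cutoff (t : ℝ) (x : Space d) : ℝ :=
  min 1 (max 0 (2 - 4 * Metric.infDist x (core d t)))

lemma cutoff_eq_one {t : ℝ} {x : Space d} (hx : Metric.infDist x (core d t) ≤ 1 / 4) :
    cutoff t x = 1 :=
  min_eq_left (le_max_of_le_right (by linarith))

lemma cutoff_eq_zero {t : ℝ} {x : Space d} (hx : 1 / 2 ≤ Metric.infDist x (core d t)) :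
    cutoff t x = 0 := by
  rw [cutoff, max_eq_left (by linarith), min_eq_right zero_le_one]

lemma abs_cutoff_le (t : ℝ) (x : Space d) : |cutoff t x| ≤ 1 :=
  abs_le.2 ⟨by linarith [show 0 ≤ cutoff t x from le_min zero_le_one (le_max_left _ _)],
    min_le_left _ _⟩

lemma lipschitzWith_cutoff (t : ℝ) : LipschitzWith 4 (cutoff t : Space d → ℝ) := by
  refine LipschitzWith.const_min (LipschitzWith.const_max ?_ _) _
  refine LipschitzWith.of_dist_le_mul fun x y => ?_
  have := (Metric.lipschitz_infDist_pt (core d t)).dist_le_mul x y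
  rw [Real.dist_eq] at this ⊢
  rw [show 2 - 4 * Metric.infDist x (core d t) - (2 - 4 * Metric.infDist y (core d t)) =
    -4 * (Metric.infDist x (core d t) - Metric.infDist y (core d t)) by ring, abs_mul]
  norm_num at this ⊢
  exact this

lemma mem_wideSlab_of_infDist_le {t : ℝ} {x : Space d}
    (hx : Metric.infDist x (core d t) ≤ 1 / 2) : x ∈ wideSlab d (t - 1) := by
  -- Any radius in (1/2, 1) serves: above 1/2 it yields a point of the core, and below 1 it keeps x
  -- in the wide slab.
  obtain ⟨y, ⟨hy1, hy2, hy3⟩, hxy⟩ :=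
    (Metric.infDist_lt_iff (core_nonempty t)).1 (hx.trans_lt (by norm_num : (1 / 2 : ℝ) < 3 / 4))
  rw [dist_eq_norm] at hxy
  have h1 := (norm_base_le (x - y)).trans hxy.le
  have h2 := abs_le.1 ((abs_height_le (x - y)).trans hxy.le)
  rw [base_sub] at h1
  rw [height_sub] at h2
  have h3 := norm_sub_norm_le (base x) (base y)
  exact ⟨by linarith, by linarith, by linarith⟩

lemma isBounded_wideSlab (s : ℝ) : Bornology.IsBounded (wideSlab d s) := by
  refine isBounded_iff_forall_norm_le.2 ⟨2 + |s| + 3, fun x ⟨h1, h2, h3⟩ => ?_⟩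
  refine abs_le_of_sq_le_sq' ?_ (by positivity) |>.2
  have h : |height x| ≤ |s| + 3 :=
    abs_le.2 ⟨by linarith [neg_abs_le s], by linarith [le_abs_self s]⟩
  rw [norm_sq_eq, ← sq_abs (height x)]
  nlinarith [norm_nonneg (base x), abs_nonneg (height x), abs_nonneg s]

lemma slab_subset_wideSlab (s : ℝ) : slab d s ⊆ wideSlab d s :=
  fun _ hx => ⟨hx.1.trans one_le_two, hx.2⟩

/-- The extension of `φ` across the lateral surface by reflection, cut off near `core d t`. -/
noncomputable def extend (t : ℝ) (φ : Space d → ℝ) (x : Space d) : ℝ := cutoff t x * φ (fold x)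

lemma tsupport_extend_subset (t : ℝ) (φ : Space d → ℝ) :
    tsupport (extend t φ) ⊆ {x | Metric.infDist x (core d t) ≤ 1 / 2} := by
  refine closure_minimal (fun x hx => ?_)
    (isClosed_le (Metric.continuous_infDist_pt _) continuous_const)
  by_contra h
  rw [mem_ofPred_eq, not_le] at h
  exact hx (by rw [extend, cutoff_eq_zero h.le, zero_mul])

lemma tsupport_extend_subset_wideSlab (t : ℝ) (φ : Space d → ℝ) :
    tsupport (extend t φ) ⊆ wideSlab d (t - 1) :=
  (tsupport_extend_subset t φ).trans fun _ => mem_wideSlab_of_infDist_le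

lemma hasCompactSupport_extend (t : ℝ) (φ : Space d → ℝ) : HasCompactSupport (extend t φ) :=
  Metric.isCompact_of_isClosed_isBounded (isClosed_tsupport _)
    ((isBounded_wideSlab _).subset (tsupport_extend_subset_wideSlab t φ))

lemma exists_lipschitzWith_extend (t : ℝ) {Ω : Set (Space d)} {φ : Space d → ℝ}
    (hφ : IsTest Ω φ) : ∃ L : ℝ≥0, LipschitzWith L (extend t φ) := by
  obtain ⟨L, hL⟩ := hφ.1.lipschitzWith_of_hasCompactSupport hφ.2.1 (by simp)
  obtain ⟨M, hM⟩ := hφ.1.continuous.bounded_above_of_compact_support hφ.2.1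
  have hM0 : 0 ≤ M := (norm_nonneg _).trans (hM 0)
  refine ⟨L + 4 * M.toNNReal, LipschitzWith.of_dist_le_mul fun x y => ?_⟩
  have h1 := (hL.comp lipschitzWith_fold).dist_le_mul x y
  have h2 := (lipschitzWith_cutoff t).dist_le_mul x y
  simp only [Function.comp_apply, mul_one] at h1
  push_cast at h2 ⊢
  rw [Real.coe_toNNReal M hM0]
  rw [Real.dist_eq] at *
  calc |extend t φ x - extend t φ y|
      = |cutoff t x * (φ (fold x) - φ (fold y)) + (cutoff t x - cutoff t y) * φ (fold y)| := by
        rw [extend, extend]; ring_nf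
    _ ≤ 1 * (L * dist x y) + 4 * dist x y * M := by
        refine (abs_add_le _ _).trans ?_
        rw [abs_mul, abs_mul]
        have := hM (fold y)
        rw [Real.norm_eq_abs] at this
        gcongr
        exact abs_cutoff_le t x
    _ = _ := by ring

/-- Product and chain rules at points where the cutoff and `fold` are differentiable. The factors 4
and 1 are their Lipschitz constants. -/
lemma ae_enorm_fderiv_extend_le (t : ℝ) {Ω : Set (Space d)} {φ : Space d → ℝ}
    (hφ : IsTest Ω φ) :
    ∀ᵐ x, ‖fderiv ℝ (extend t φ) x‖ₑ ≤ 4 * ‖φ (fold x)‖ₑ + ‖fderiv ℝ φ (fold x)‖ₑ := by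
  filter_upwards [(lipschitzWith_cutoff t).ae_differentiableAt (E := Space d),
    lipschitzWith_fold.ae_differentiableAt] with x h1 h2
  have h3 := (hφ.1.differentiable (by simp) (fold x)).hasFDerivAt.comp x h2.hasFDerivAt
  have h4 := (h1.hasFDerivAt.mul h3).fderiv
  have h5 : ‖fderiv ℝ (cutoff t) x‖ ≤ 4 := by
    simpa using norm_fderiv_le_of_lipschitz ℝ (lipschitzWith_cutoff t)
  have h6 : ‖fderiv ℝ fold x‖ ≤ 1 := by
    simpa using norm_fderiv_le_of_lipschitz ℝ (lipschitzWith_fold (d := d))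
  have h7 : ‖fderiv ℝ (extend t φ) x‖ ≤ 4 * ‖φ (fold x)‖ + ‖fderiv ℝ φ (fold x)‖ := by
    have : fderiv ℝ (extend t φ) x = _ := h4
    rw [this]
    refine (norm_add_le _ _).trans ?_
    rw [add_comm, norm_smul, norm_smul]
    refine add_le_add ?_ ?_
    · rw [mul_comm, Function.comp_apply]; gcongr
    · calc _ ≤ 1 * (‖fderiv ℝ φ (fold x)‖ * 1) := by
            refine mul_le_mul (abs_cutoff_le t x) ?_ (norm_nonneg _) zero_le_one
            exact (ContinuousLinearMap.opNorm_comp_le _ _).trans (by gcongr)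
        _ = _ := by ring
  simp only [← ofReal_norm]
  rw [show (4 : ℝ≥0∞) = ENNReal.ofReal 4 by simp, ← ENNReal.ofReal_mul (by norm_num),
    ← ENNReal.ofReal_add (by positivity) (by positivity)]
  exact ENNReal.ofReal_le_ofReal h7

lemma setLIntegral_wideSlab_comp_fold_le (s : ℝ) {f : Space d → ℝ≥0∞}
    (hf : AEMeasurable f (volume.restrict (slab d s))) :
    ∫⁻ x in wideSlab d s, f (fold x) ≤ (1 + 4 ^ (d + 1)) * ∫⁻ x in slab d s, f x := by
  have hm : Measurable (fold : Space d → Space d) := lipschitzWith_fold.continuous.measurable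
  have hf' : AEMeasurable f ((volume.restrict (wideSlab d s)).map fold) :=
    (hf.smul_measure _).mono_measure (map_fold_le s)
  rw [← lintegral_map' hf' hm.aemeasurable, ← smul_eq_mul, ← lintegral_smul_measure]
  exact lintegral_mono' (map_fold_le s) le_rfl

/-- The bound for the Sobolev norm of the extension in terms of the gradient in the cylinder. -/
noncomputable def extendConst (d : ℕ) (p : ℝ) : ℝ≥0∞ :=
  (1 + 2 ^ (p - 1) * 4 ^ p) * ((1 + 4 ^ (d + 1)) * (3 ^ p + 1))

/-- The three factors of `extendConst` come from the pointwise derivative bound, the change of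
variables by `fold`, and the Poincaré inequality. -/
lemma lintegral_extend_le {p : ℝ} (hp : 1 ≤ p) {t : ℝ} (ht : 1 ≤ t) {φ : Space d → ℝ}
    (hφ : IsTest (bottom d (t - 1))ᶜ φ) :
    ∫⁻ x, (‖extend t φ x‖ₑ ^ p + ‖fderiv ℝ (extend t φ) x‖ₑ ^ p) ≤
      extendConst d p * ∫⁻ x in slab d (t - 1), ‖fderiv ℝ φ x‖ₑ ^ p := by
  have hp0 : 0 < p := by linarith
  set f : Space d → ℝ≥0∞ := fun y => ‖φ y‖ₑ ^ p + ‖fderiv ℝ φ y‖ₑ ^ p with hf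
  have hφm : Measurable φ := hφ.1.continuous.measurable
  have hdm := measurable_fderiv ℝ φ
  have hfm : Measurable f := by fun_prop
  set c : ℝ≥0∞ := 1 + 2 ^ (p - 1) * 4 ^ p with hc
  have hctop : c ≠ ⊤ := by simp [hc, ENNReal.mul_eq_top]
  have h4 : (1 : ℝ≥0∞) ≤ 4 ^ p := ENNReal.one_le_rpow (by norm_num) hp0
  calc ∫⁻ x, (‖extend t φ x‖ₑ ^ p + ‖fderiv ℝ (extend t φ) x‖ₑ ^ p)
      ≤ ∫⁻ x, (wideSlab d (t - 1)).indicator (fun x => c * f (fold x)) x := by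
        refine lintegral_mono_ae ?_
        filter_upwards [ae_enorm_fderiv_extend_le t hφ] with x hx
        by_cases hxs : x ∈ wideSlab d (t - 1)
        · rw [indicator_of_mem hxs, hc, hf]
          have h1 : ‖extend t φ x‖ₑ ≤ ‖φ (fold x)‖ₑ := by
            rw [extend, enorm_mul]
            refine mul_le_of_le_one_left' ?_
            rw [← ofReal_norm, Real.norm_eq_abs]
            exact ENNReal.ofReal_le_one.2 (abs_cutoff_le t x)
          have h2 : ‖fderiv ℝ (extend t φ) x‖ₑ ^ p ≤
              2 ^ (p - 1) * 4 ^ p * (‖φ (fold x)‖ₑ ^ p + ‖fderiv ℝ φ (fold x)‖ₑ ^ p) := by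
            refine (ENNReal.rpow_le_rpow hx hp0.le).trans
              ((ENNReal.rpow_add_le_mul_rpow_add_rpow _ _ hp).trans ?_)
            rw [ENNReal.mul_rpow_of_nonneg _ _ hp0.le, mul_assoc, mul_add (4 ^ p)]
            gcongr
            exact le_mul_of_one_le_left' h4
          rw [add_mul, one_mul]
          refine add_le_add ((ENNReal.rpow_le_rpow h1 hp0.le).trans le_self_add) h2
        · have hxt : x ∉ tsupport (extend t φ) := fun h =>
            hxs (tsupport_extend_subset_wideSlab t φ h)
          rw [indicator_of_notMem hxs, image_eq_zero_of_notMem_tsupport hxt,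
            fderiv_of_notMem_tsupport ℝ hxt, ← ofReal_norm, ← ofReal_norm, norm_zero, norm_zero]
          simp [hp0]
    _ = c * ∫⁻ x in wideSlab d (t - 1), f (fold x) := by
        rw [lintegral_indicator (measurableSet_wideSlab _), lintegral_const_mul' _ _ hctop]
    _ ≤ c * ((1 + 4 ^ (d + 1)) * ∫⁻ x in slab d (t - 1), f x) :=
        mul_le_mul_right (setLIntegral_wideSlab_comp_fold_le _ hfm.aemeasurable) _
    _ ≤ c * ((1 + 4 ^ (d + 1)) *
          ((3 ^ p + 1) * ∫⁻ x in slab d (t - 1), ‖fderiv ℝ φ x‖ₑ ^ p)) := by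
        refine mul_le_mul_right (mul_le_mul_right ?_ _) _
        rw [hf, lintegral_add_left (by fun_prop), add_mul, one_mul]
        exact add_le_add (lintegral_slab_le hp (by linarith) hφ) le_rfl
    _ = _ := by rw [extendConst]; ring

end Extension

/-! ### Comparison of the capacities -/

section Capacity

variable {d : ℕ}

lemma openCyl_diff_bottom {s : ℝ} (hs : 0 ≤ s) :
    openCyl d \ bottom d s = {x | ‖base x‖ < 1 ∧ s < height x} := by
  ext x
  simp only [openCyl, bottom, Set.mem_sdiff, mem_ofPred_eq, not_and, not_le]
  refine ⟨fun h => ⟨h.1.1, h.2 h.1.1.le h.1.2.le⟩, fun h => ⟨⟨h.1, by linarith [h.2]⟩,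
    fun _ _ => h.2⟩⟩

lemma openCyl_diff_bottom_ae_eq {s : ℝ} (hs : 0 ≤ s) :
    (openCyl d \ bottom d s : Set (Space d)) =ᵐ[volume] trunc d s := by
  have h : ∀ᵐ x : Space d, ‖base x‖ ≠ 1 := by
    rw [ae_iff]; simpa using volume_norm_base_eq_one
  rw [openCyl_diff_bottom hs]
  filter_upwards [h] with x hx
  refine propext ⟨fun h => ⟨h.1.le, h.2⟩, fun h => ⟨lt_of_le_of_ne h.1 hx, h.2⟩⟩

lemma slab_subset_trunc (s : ℝ) : slab d s ⊆ trunc d s := fun _ hx => ⟨hx.1, hx.2.1⟩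

lemma restrict_slab_le {s : ℝ} (hs : 0 ≤ s) :
    volume.restrict (slab d s) ≤ volume.restrict (openCyl d \ bottom d s) := by
  rw [Measure.restrict_congr_set (openCyl_diff_bottom_ae_eq hs)]
  exact Measure.restrict_mono (slab_subset_trunc s) le_rfl

lemma volume_slab_lt_top (s : ℝ) : volume (slab d s) < ⊤ :=
  ((isBounded_wideSlab s).subset (slab_subset_wideSlab s)).measure_lt_top

lemma subset_core {t : ℝ} {E : Set (Space d)}
    (hE : E ⊆ closure (trunc d t) \ trunc d (t + 1)) : E ⊆ core d t := by
  intro x hx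
  have hcl : IsClosed {x : Space d | ‖base x‖ ≤ 1 ∧ t ≤ height x} :=
    (isClosed_le continuous_base.norm continuous_const).inter
      (isClosed_le continuous_const continuous_height)
  have hsub : trunc d t ⊆ {x : Space d | ‖base x‖ ≤ 1 ∧ t ≤ height x} :=
    fun y hy => ⟨hy.1, hy.2.le⟩
  have h1 := closure_minimal hsub hcl (hE hx).1
  exact ⟨h1.1, h1.2, not_lt.1 fun h => (hE hx).2 ⟨h1.1, h⟩⟩

/-- Minkowski's inequality, in a form whose error term tends to zero along the approximating
sequence. -/
lemma lintegral_gradient_rpow_le {κ p s : ℝ} (hp : 1 ≤ p) {v : Space d → ℝ}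
    {g : Space d → Space d} {φ : Space d → ℝ}
    (hg : AEStronglyMeasurable g (volume.restrict (openCyl d \ bottom d s)))
    (hφ : Continuous (∇ φ)) :
    ∫⁻ x in openCyl d \ bottom d s, ‖∇ φ x‖ₑ ^ p ≤
      ((∫⁻ x in openCyl d \ bottom d s, ‖g x‖ₑ ^ p) ^ (1 / p) +
        wNorm κ p (openCyl d \ bottom d s) (fun x => v x - φ x) (fun x => g x - ∇ φ x)) ^ p := by
  have hp0 : 0 < p := by linarith
  set O := openCyl d \ bottom d s
  have hd : AEStronglyMeasurable (fun x => g x - ∇ φ x) (volume.restrict O) :=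
    hg.sub hφ.aestronglyMeasurable
  have h1 : (∫⁻ x in O, ‖∇ φ x‖ₑ ^ p) ^ (1 / p) ≤
      (∫⁻ x in O, ‖g x‖ₑ ^ p) ^ (1 / p) + (∫⁻ x in O, ‖g x - ∇ φ x‖ₑ ^ p) ^ (1 / p) := by
    refine le_trans ?_ (ENNReal.lintegral_Lp_add_le hg.enorm hd.enorm hp)
    gcongr with x
    calc ‖∇ φ x‖ₑ = ‖g x - (g x - ∇ φ x)‖ₑ := by rw [sub_sub_cancel]
      _ ≤ ‖g x‖ₑ + ‖g x - ∇ φ x‖ₑ := enorm_sub_le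
  rw [one_div, ENNReal.rpow_inv_le_iff hp0] at h1
  refine h1.trans (ENNReal.rpow_le_rpow (add_le_add (by rw [one_div]) ?_) hp0.le)
  rw [wNorm, one_div]
  gcongr with x
  exact le_add_self

/-- The weight is bounded below on the slab. The factor grows with s, harmlessly: it serves only to
show convergence at a fixed level. -/
lemma setLIntegral_slab_rpow_le {κ p s : ℝ} (hp : 1 ≤ p) (hκ : 0 < κ) (hs : 0 ≤ s)
    (w : Space d → ℝ) (g : Space d → Space d) :
    ∫⁻ x in slab d s, ‖w x‖ₑ ^ p ≤ ENNReal.ofReal (Real.exp (p * κ * (s + 3))) *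
      wNorm κ p (openCyl d \ bottom d s) w g ^ p := by
  have hp0 : 0 < p := by linarith
  rw [wNorm, ← ENNReal.rpow_mul, one_div, inv_mul_cancel₀ hp0.ne', ENNReal.rpow_one]
  calc ∫⁻ x in slab d s, ‖w x‖ₑ ^ p
      ≤ ∫⁻ x in slab d s, ENNReal.ofReal (Real.exp (p * κ * (s + 3))) *
          (‖w x‖ₑ ^ p * ENNReal.ofReal (Real.exp (-(p * κ * height x))) + ‖g x‖ₑ ^ p) := by
        refine setLIntegral_mono' (measurableSet_slab s) fun x hx => ?_
        refine le_trans ?_ (mul_le_mul_right le_self_add _)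
        rw [mul_left_comm, ← ENNReal.ofReal_mul (Real.exp_pos _).le, ← Real.exp_add]
        refine le_mul_of_one_le_right' (ENNReal.one_le_ofReal.2 (Real.one_le_exp ?_))
        have : p * κ * height x ≤ p * κ * (s + 3) := by
          gcongr; exact hx.2.2.le
        linarith
    _ = ENNReal.ofReal (Real.exp (p * κ * (s + 3))) * ∫⁻ x in slab d s,
          (‖w x‖ₑ ^ p * ENNReal.ofReal (Real.exp (-(p * κ * height x))) + ‖g x‖ₑ ^ p) :=
        lintegral_const_mul' _ _ ENNReal.ofReal_ne_top
    _ ≤ _ := mul_le_mul_right (lintegral_mono' (restrict_slab_le hs) le_rfl) _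

lemma tendsto_setLIntegral_slab {κ p s : ℝ} (hp : 1 ≤ p) (hκ : 0 < κ) (hs : 0 ≤ s)
    {w : ℕ → Space d → ℝ} {g : ℕ → Space d → Space d}
    (hw : ∀ j, AEStronglyMeasurable (w j) (volume.restrict (slab d s)))
    (hlim : Tendsto (fun j => wNorm κ p (openCyl d \ bottom d s) (w j) (g j)) atTop (𝓝 0)) :
    Tendsto (fun j => ∫⁻ x in slab d s, ‖w j x‖ₑ) atTop (𝓝 0) := by
  have hp0 : 0 < p := by linarith
  have hfin : volume (slab d s) ≠ ⊤ := (volume_slab_lt_top s).ne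
  set a : ℝ≥0∞ := ENNReal.ofReal (Real.exp (p * κ * (s + 3))) with ha
  set b : ℝ≥0∞ := volume (slab d s) ^ (1 - 1 / p) with hb
  have hbtop : b ≠ ⊤ := ENNReal.rpow_ne_top_of_nonneg
    (by rw [sub_nonneg, div_le_one hp0]; exact hp) hfin
  have hatop : a ^ (1 / p) ≠ ⊤ :=
    ENNReal.rpow_ne_top_of_nonneg (by positivity) ENNReal.ofReal_ne_top
  refine tendsto_of_tendsto_of_tendsto_of_le_of_le tendsto_const_nhds
    (h := fun j => a ^ (1 / p) * wNorm κ p (openCyl d \ bottom d s) (w j) (g j) * b)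
    ?_ (fun _ => zero_le) fun j => ?_
  · have := ENNReal.Tendsto.mul_const (ENNReal.Tendsto.const_mul hlim (.inr hatop)) (.inr hbtop)
    simpa using this
  · have h1 := eLpNorm_le_eLpNorm_mul_rpow_measure_univ (p := 1) (q := ENNReal.ofReal p)
      (by simpa using hp) (hw j)
    rw [eLpNorm_one_eq_lintegral_enorm, eLpNorm_eq_lintegral_rpow_enorm_toReal
      (p := ENNReal.ofReal p) (by simpa using hp0) (by simp), ENNReal.toReal_ofReal hp0.le,
      Measure.restrict_apply_univ] at h1
    simp only [ENNReal.toReal_one, div_one] at h1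
    refine h1.trans (mul_le_mul_left ?_ _)
    refine (ENNReal.rpow_le_rpow (setLIntegral_slab_rpow_le hp hκ hs (w j) (g j))
      (by positivity)).trans_eq ?_
    rw [ENNReal.mul_rpow_of_nonneg _ _ (by positivity), ← ENNReal.rpow_mul,
      mul_one_div_cancel hp0.ne', ENNReal.rpow_one]

/-- By `map_fold_le`, preimages of null sets under `fold` are null in the wide slab. -/
lemma ae_fold_mem_imp {s : ℝ} {U : Set (Space d)} (hU : IsOpen U) {v : Space d → ℝ}
    (h : ∀ᵐ x ∂(volume.restrict (trunc d s ∩ U)), 1 ≤ v x) :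
    ∀ᵐ x ∂(volume.restrict (wideSlab d s)), fold x ∈ U → 1 ≤ v (fold x) := by
  have h1 : ∀ᵐ x ∂(volume.restrict (slab d s)), x ∈ U → 1 ≤ v x := by
    rw [inter_comm, ← Measure.restrict_restrict hU.measurableSet,
      ae_restrict_iff' hU.measurableSet] at h
    exact ae_mono (Measure.restrict_mono (slab_subset_trunc s) le_rfl) h
  have h2 : (volume.restrict (wideSlab d s)).map fold ≪ volume.restrict (slab d s) :=
    (map_fold_le s).absolutelyContinuous.trans (Measure.smul_absolutelyContinuous)
  exact ae_of_ae_map lipschitzWith_fold.continuous.measurable.aemeasurable (h2.ae_le h1)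

/-- A neighborhood of `U ∩ core d t` on which the extensions of functions that are large on `U`
remain large. -/
def foldNhd (t : ℝ) (U : Set (Space d)) : Set (Space d) :=
  fold ⁻¹' U ∩ {x | Metric.infDist x (core d t) < 1 / 4}

lemma isOpen_foldNhd (t : ℝ) {U : Set (Space d)} (hU : IsOpen U) : IsOpen (foldNhd t U) :=
  (hU.preimage lipschitzWith_fold.continuous).inter
    (isOpen_lt (Metric.continuous_infDist_pt _) continuous_const)

lemma foldNhd_subset_wideSlab (t : ℝ) (U : Set (Space d)) :
    foldNhd t U ⊆ wideSlab d (t - 1) := fun _ hx =>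
  mem_wideSlab_of_infDist_le (le_of_lt (lt_trans hx.2 (by norm_num)))

lemma subset_foldNhd {t : ℝ} {U E : Set (Space d)} (hE : E ⊆ core d t) (hU : E ⊆ U) :
    E ⊆ foldNhd t U := fun x hx =>
  ⟨by rw [mem_preimage, fold_of_le (hE hx).1]; exact hU hx,
    by rw [mem_ofPred_eq, Metric.infDist_zero_of_mem (hE hx)]; norm_num⟩

lemma le_mollify_of_lintegral_le (ρ : ContDiffBump (0 : Space d)) {V : Space d → ℝ}
    (hV : Continuous V) (hc : HasCompactSupport V) {x : Space d} {c : ℝ} (hc1 : c ≤ 1)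
    (h : ∫⁻ y, ENNReal.ofReal (1 - V (x - y)) ∂bumpMeasure ρ ≤ ENNReal.ofReal (1 - c)) :
    c ≤ mollify ρ V x := by
  obtain ⟨M, hM⟩ := hV.bounded_above_of_compact_support hc
  have hi : Integrable (fun y => V (x - y)) (bumpMeasure ρ) :=
    (integrable_const M).mono' (hV.comp (by fun_prop)).aestronglyMeasurable
      (ae_of_all _ fun y => hM _)
  have hi1 : Integrable (fun y => 1 - V (x - y)) (bumpMeasure ρ) := (integrable_const 1).sub hi
  have h1 : ∫ y, (1 - V (x - y)) ∂bumpMeasure ρ ≤ 1 - c := by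
    rw [integral_eq_lintegral_pos_part_sub_lintegral_neg_part hi1]
    refine (sub_le_self _ ENNReal.toReal_nonneg).trans ?_
    exact (ENNReal.toReal_mono ENNReal.ofReal_ne_top h).trans_eq
      (ENNReal.toReal_ofReal (by linarith))
  rw [integral_sub (integrable_const 1) hi] at h1
  simp only [integral_const, probReal_univ, smul_eq_mul, mul_one] at h1
  rw [mollify]; linarith

/-- On `foldNhd t U` the cutoff is 1 and v ∘ `fold` ≥ 1 almost everywhere, so the deficit 1 - φ ∘
`fold` is at most |v - φ| ∘ `fold`. Outside its ball the bump density vanishes. -/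
lemma lintegral_bumpMeasure_le (ρ : ContDiffBump (0 : Space d)) {t : ℝ} {U : Set (Space d)}
    (hU : IsOpen U) {v φ : Space d → ℝ}
    (hw : AEStronglyMeasurable (fun x => v x - φ x) (volume.restrict (slab d (t - 1))))
    (hv : ∀ᵐ x ∂(volume.restrict (trunc d (t - 1) ∩ U)), 1 ≤ v x) {M : ℝ}
    (hM : ∀ y, ρ.normed volume y ≤ M) {x : Space d}
    (hx : Metric.ball x ρ.rOut ⊆ foldNhd t U) :
    ∫⁻ y, ENNReal.ofReal (1 - extend t φ (x - y)) ∂bumpMeasure ρ ≤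
      ENNReal.ofReal M *
        ((1 + 4 ^ (d + 1)) * ∫⁻ z in slab d (t - 1), ‖v z - φ z‖ₑ) := by
  set f : Space d → ℝ≥0∞ := fun z => (foldNhd t U).indicator
    (fun z => ‖v (fold z) - φ (fold z)‖ₑ) z with hf
  have hWm := (isOpen_foldNhd t hU).measurableSet
  have hv' : ∀ᵐ z, z ∈ wideSlab d (t - 1) → fold z ∈ U → 1 ≤ v (fold z) :=
    (ae_restrict_iff' (measurableSet_wideSlab _)).1 (ae_fold_mem_imp hU hv)
  calc ∫⁻ y, ENNReal.ofReal (1 - extend t φ (x - y)) ∂bumpMeasure ρ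
      ≤ ∫⁻ y, ENNReal.ofReal (ρ.normed volume y) * ENNReal.ofReal (1 - extend t φ (x - y)) := by
        rw [bumpMeasure]
        exact lintegral_withDensity_le_lintegral_mul _
          ρ.continuous_normed.measurable.ennreal_ofReal _
    _ ≤ ∫⁻ y, ENNReal.ofReal M * f (x - y) := by
        refine lintegral_mono_ae ?_
        filter_upwards [ae_sub_left hv' x] with y hy
        by_cases hyb : y ∈ Metric.ball (0 : Space d) ρ.rOut
        · have hxy : x - y ∈ foldNhd t U := hx (by simpa [dist_eq_norm] using hyb)
          refine mul_le_mul' (ENNReal.ofReal_le_ofReal (hM y)) ?_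
          rw [hf]
          simp only [indicator_of_mem hxy]
          rw [extend, cutoff_eq_one (le_of_lt hxy.2), one_mul, ← ofReal_norm]
          refine ENNReal.ofReal_le_ofReal ((?_ : _ ≤ _).trans (le_abs_self _))
          linarith [hy (foldNhd_subset_wideSlab t U hxy) hxy.1]
        · rw [← ρ.support_normed_eq (μ := volume), Function.notMem_support] at hyb
          simp [hyb]
    _ = ENNReal.ofReal M * ∫⁻ z in foldNhd t U, ‖v (fold z) - φ (fold z)‖ₑ := by
        rw [lintegral_const_mul' _ _ ENNReal.ofReal_ne_top, lintegral_sub_left_eq_self f x, hf,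
          lintegral_indicator hWm]
    _ ≤ ENNReal.ofReal M * ∫⁻ z in wideSlab d (t - 1), ‖v (fold z) - φ (fold z)‖ₑ :=
        mul_le_mul_right (lintegral_mono_set (foldNhd_subset_wideSlab t U)) _
    _ ≤ _ := mul_le_mul_right (setLIntegral_wideSlab_comp_fold_le _ hw.enorm) _

lemma IsTest.continuous_gradient {Ω : Set (Space d)} {φ : Space d → ℝ} (hφ : IsTest Ω φ) :
    Continuous (∇ φ) :=
  (InnerProductSpace.toDual ℝ (Space d)).symm.continuous.comp (hφ.1.continuous_fderiv (by simp))

lemma sobolevCapCompact_le {κ p t : ℝ} (hp : 1 ≤ p) (hκ : 0 < κ) (ht : 1 ≤ t)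
    {v : Space d → ℝ} {g : Space d → Space d} (hvg : MemLZero κ p (bottom d (t - 1)) v g)
    {U : Set (Space d)} (hU : IsOpen U)
    (hv : ∀ᵐ x ∂(volume.restrict (trunc d (t - 1) ∩ U)), 1 ≤ v x)
    {K : Set (Space d)} (hK : IsCompact K) (hKU : K ⊆ foldNhd t U) :
    sobolevCapCompact p K ≤
      2 ^ p * extendConst d p * ∫⁻ x in trunc d (t - 1), ‖g x‖ₑ ^ p := by
  have hp0 : 0 < p := by linarith
  have hs : 0 ≤ t - 1 := by linarith
  obtain ⟨⟨⟨hvl, hgl, -⟩, -⟩, φ, hφ, hlim⟩ := hvg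
  have hOm : MeasurableSet (openCyl d \ bottom d (t - 1)) := by
    rw [openCyl_diff_bottom hs]
    exact ((isOpen_lt continuous_base.norm continuous_const).inter
      (isOpen_lt continuous_const continuous_height)).measurableSet
  have hw : ∀ j, AEStronglyMeasurable (fun x => v x - φ j x)
      (volume.restrict (slab d (t - 1))) := fun j =>
    (hvl.aestronglyMeasurable.mono_measure (restrict_slab_le hs)).sub
      (hφ j).1.continuous.aestronglyMeasurable
  obtain ⟨δ, hδ, hδK⟩ := hK.exists_thickening_subset_open (isOpen_foldNhd t hU) hKU
  -- The mollifier depends on K alone and is fixed before j, so the bound M on its density cannot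
  -- spoil the limit.
  let ρ : ContDiffBump (0 : Space d) := ⟨δ / 2, δ, by positivity, by linarith⟩
  obtain ⟨M, hM⟩ := ρ.continuous_normed.bounded_above_of_compact_support
    (ρ.hasCompactSupport_normed (μ := volume))
  -- A deficit of at most 1/2 leaves the mollification at least 1/2 on K; rescaling by 2 produces
  -- the factor `2 ^ p`.
  have hsmall : ∀ᶠ j in atTop, ENNReal.ofReal M *
      ((1 + 4 ^ (d + 1)) * ∫⁻ z in slab d (t - 1), ‖v z - φ j z‖ₑ) ≤
        ENNReal.ofReal (1 - 1 / 2) := by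
    have h1 := tendsto_setLIntegral_slab hp hκ hs hw hlim
    have h2 := ENNReal.Tendsto.const_mul (a := ENNReal.ofReal M)
      (ENNReal.Tendsto.const_mul (a := 1 + 4 ^ (d + 1)) h1 (.inr (by simp)))
      (.inr ENNReal.ofReal_ne_top)
    rw [mul_zero, mul_zero] at h2
    exact (h2.eventually_lt_const (ENNReal.ofReal_pos.2 (by norm_num))).mono fun _ h => h.le
  have hbound : ∀ᶠ j in atTop, sobolevCapCompact p K ≤ 2 ^ p * extendConst d p *
      ((∫⁻ x in openCyl d \ bottom d (t - 1), ‖g x‖ₑ ^ p) ^ (1 / p) +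
        wNorm κ p (openCyl d \ bottom d (t - 1)) (fun x => v x - φ j x)
          (fun x => g x - ∇ (φ j) x)) ^ p := by
    filter_upwards [hsmall] with j hj
    obtain ⟨L, hL⟩ := exists_lipschitzWith_extend t (hφ j)
    have hc := hasCompactSupport_extend t (φ j)
    have h1 := sobolevCapCompact_le_of_le_mollify ρ hp hL hc (K := K) (c := 1 / 2) (by norm_num)
      fun x hx => le_mollify_of_lintegral_le ρ hL.continuous hc (by norm_num)
        ((lintegral_bumpMeasure_le ρ hU (hw j) hv (fun y => (le_abs_self _).trans (hM y))
          ((Metric.ball_subset_thickening hx δ).trans hδK)).trans hj)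
    have h2 : ‖(1 / 2 : ℝ)⁻¹‖ₑ = 2 := by
      rw [← ofReal_norm]; norm_num
    rw [h2] at h1
    refine h1.trans ?_
    rw [mul_assoc]
    refine mul_le_mul_right ((lintegral_extend_le hp ht (hφ j)).trans (mul_le_mul_right ?_ _)) _
    simp only [← enorm_gradient]
    exact (lintegral_mono' (restrict_slab_le hs) le_rfl).trans
      (lintegral_gradient_rpow_le hp hgl.aestronglyMeasurable (hφ j).continuous_gradient)
  refine ge_of_tendsto ?_ hbound
  have hctop : 2 ^ p * extendConst d p ≠ ⊤ := by
    simp [extendConst, ENNReal.mul_eq_top]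
  refine ENNReal.Tendsto.const_mul ?_ (.inr hctop)
  have h3 := (ENNReal.continuous_rpow_const (y := p)).tendsto _ |>.comp
    ((tendsto_const_nhds (x := (∫⁻ x in openCyl d \ bottom d (t - 1), ‖g x‖ₑ ^ p) ^ (1 / p))).add
      hlim)
  rw [add_zero, ← ENNReal.rpow_mul, one_div, inv_mul_cancel₀ hp0.ne', ENNReal.rpow_one] at h3
  rw [← setLIntegral_congr (openCyl_diff_bottom_ae_eq hs)]
  simpa only [one_div, Function.comp_def] using h3

lemma sobolevCap_le {κ p t : ℝ} (hp : 1 ≤ p) (hκ : 0 < κ) (ht : 1 ≤ t) {E : Set (Space d)}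
    (hE : E ⊆ closure (trunc d t) \ trunc d (t + 1)) :
    sobolevCap p E ≤ 2 ^ p * extendConst d p * neumannCap κ p (t - 1) E := by
  have hctop : 2 ^ p * extendConst d p ≠ ⊤ := by
    simp [extendConst, ENNReal.mul_eq_top]
  have hc0 : 2 ^ p * extendConst d p ≠ 0 := by
    simp [extendConst]
  -- Dividing by the constant isolates the infimum, so each competitor can be treated separately.
  rw [mul_comm, ← ENNReal.div_le_iff hc0 hctop]
  refine le_iInf₂ fun v g => le_iInf₂ fun hvg ⟨U, hU, hEU, hv⟩ => ?_
  rw [ENNReal.div_le_iff hc0 hctop, mul_comm]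
  refine iInf₂_le_of_le (foldNhd t U) (isOpen_foldNhd t hU)
    (iInf_le_of_le (subset_foldNhd (subset_core hE) hEU) ?_)
  exact iSup₂_le fun K hK => iSup_le fun hKU => sobolevCapCompact_le hp hκ ht hvg hU hv hK hKU

end Capacity

end HalfCylinder

/-- Here `n = d + 1 ≥ 2`. -/
theorem lemma7p7 (d : ℕ) (hd : 1 ≤ d) (p : ℝ) (hp : 1 < p) (κ : ℝ) (hκ : 0 < κ) :
    ∃ C : ℝ≥0, ∀ t : ℝ, 1 ≤ t → ∀ E : Set (HalfCylinder.Space d),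
      E ⊆ closure (HalfCylinder.trunc d t) \ HalfCylinder.trunc d (t + 1) →
        HalfCylinder.sobolevCap p E ≤ (C : ℝ≥0∞) * HalfCylinder.neumannCap κ p (t - 1) E := by
  refine ⟨(2 ^ p * HalfCylinder.extendConst d p).toNNReal, fun t ht E hE => ?_⟩
  rw [ENNReal.coe_toNNReal (by simp [HalfCylinder.extendConst, ENNReal.mul_eq_top])]
  exact HalfCylinder.sobolevCap_le hp.le hκ ht hE
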